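/- Let $G$ be a (discrete) group and let $\mathcal F$ be a family of subgroups of $G$, i.e. a non-empty set of subgroups that is closed under conjugation by elements of $G$ and under taking subgroups. Let $G/\mathcal F=\coprod_{H\in\mathcal F}G/H$. A normed $\mathbb R G$-module is a real normed space $W$ with a linear isometric $G$-action; for such a $W$ let $H^n_{\mathcal F,b}(G;W)$ and $H^n_b(G;W)$ be the $n$-th cohomology of the complexes of bounded $G$-equivariant maps $(G/\mathcal F)^{*+1}\to W$ and $G^{*+1}\to W$, respectively, with the differential $(\delta f)(x_0,\dots,x_{n+1})=\sum_{i=0}^{n+1}(-1)^i f(x_0,\dots,\widehat{x_i},\dots,x_{n+1})$. The canonical map $H^n_{\mathcal F,b}(G;W)\to H^n_b(G;W)$ is induced by the $G$-map $G= G/1\hookrightarrow G/\mathcal F$. For a normed $\mathbb R G$-module $V$, let $V^\#$ be its topological dual with the operator norm and the action $(g\cdot\varphi)(v)=\varphi(g^{-1}v)$. The following are equivalent: (i) all subgroups in $\mathcal F$ are amenable (a group $H$ is amenable if there is a linear, normalized, non-negative, left-translation-invariant functional $\ell^\infty(H)\to\mathbb R$); (ii) the canonical map $H^n_{\mathcal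 F,b}(G;V^\#)\to H^n_b(G;V^\#)$ is an isomorphism for every normed $\mathbb R G$-module $V$ and all $n\ge 0$; (iii) the canonical map $H^1_{\mathcal F,b}(G;V^\#)\to H^1_b(G;V^\#)$ is an isomorphism for every normed $\mathbb R G$-module $V$. -/

import Mathlib

open scoped ENNReal

universe u v

/-- A family of subgroups of `G`: a non-empty set of subgroups of `G` that is closed under
conjugation by elements of `G` and under taking subgroups. -/
structure SubgroupFamily (G : Type*) [Group G] where
  /-- The underlying set of subgroups. -/
  carrier : Set (Subgroup G)
  nonempty' : carrier.Nonempty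
  conj_mem' : ∀ H ∈ carrier, ∀ g : G, H.map (MulAut.conj g).toMonoidHom ∈ carrier
  mem_of_le' : ∀ H ∈ carrier, ∀ K : Subgroup G, K ≤ H → K ∈ carrier

namespace SubgroupFamily

variable {G : Type*} [Group G]

theorem bot_mem (F : SubgroupFamily G) : (⊥ : Subgroup G) ∈ F.carrier := by
  obtain ⟨H, hH⟩ := F.nonempty'
  exact F.mem_of_le' H hH ⊥ bot_le

/-- The `G`-set `G/F`, the disjoint union of the coset spaces `G/H` over all `H ∈ F`, with `G`
acting by left translation on each summand. -/
abbrev Cosets (F : SubgroupFamily G) : Type _ :=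
  Σ H : F.carrier, G ⧸ (H : Subgroup G)

/-- The `G`-map `G → G/F` that identifies `G` with the summand `G/1` of `G/F`. -/
def toCosets (F : SubgroupFamily G) : G →[G] F.Cosets where
  toFun g := ⟨⟨⊥, F.bot_mem⟩, (g : G ⧸ (⊥ : Subgroup G))⟩
  map_smul' _ _ := rfl

end SubgroupFamily

section Amenable

/-- The translate `g · f` of a bounded function `f` on a `G`-set,
`(g · f)(s) = f (g⁻¹ · s)`. -/
def translateLp {G S : Type*} [Group G] [MulAction G S] (g : G)
    (f : lp (fun _ : S => ℝ) ∞) : lp (fun _ : S => ℝ) ∞ :=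
  ⟨fun s => f (g⁻¹ • s), memℓp_infty <| by
    obtain ⟨C, hC⟩ := memℓp_infty_iff.1 (lp.memℓp f)
    refine ⟨C, ?_⟩
    rintro _ ⟨s, rfl⟩
    exact hC ⟨g⁻¹ • s, rfl⟩⟩

/-- `m` is a `G`-invariant mean on the `G`-set `S`: a linear functional on `ℓ^∞(S)` that is
normalized, non-negative and `G`-invariant. -/
structure IsInvariantMean (G : Type*) {S : Type*} [Group G] [MulAction G S]
    (m : lp (fun _ : S => ℝ) ∞ →ₗ[ℝ] ℝ) : Prop where
  normalized : m 1 = 1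
  nonneg : ∀ f : lp (fun _ : S => ℝ) ∞, (∀ s, 0 ≤ f s) → 0 ≤ m f
  invariant : ∀ (g : G) (f : lp (fun _ : S => ℝ) ∞), m (translateLp g f) = m f

/-- A (discrete) group `G` is amenable if there is a `G`-invariant mean on `G`, where `G` acts on
itself by left translation. -/
def IsAmenableGroup (G : Type*) [Group G] : Prop :=
  ∃ m : lp (fun _ : G => ℝ) ∞ →ₗ[ℝ] ℝ, IsInvariantMean G m

end Amenable

section Dual

variable {G V : Type*} [Group G] [NormedAddCommGroup V] [NormedSpace ℝ V]

/-- A normed `ℝG`-module is a real normed space `V` with a homomorphism `ρ` from `G` to the group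
of linear isometric automorphisms of `V`. The topological dual of `V`, with the operator norm and
the action `(g · φ)(v) = φ (g⁻¹ · v)`, is again a normed `ℝG`-module. -/
noncomputable def dualAction (ρ : G →* (V ≃ₗᵢ[ℝ] V)) :
    G →* (StrongDual ℝ V ≃ₗᵢ[ℝ] StrongDual ℝ V) where
  toFun g :=
    { toFun := fun φ => φ.comp (ρ g⁻¹).toContinuousLinearEquiv.toContinuousLinearMap
      invFun := fun φ => φ.comp (ρ g).toContinuousLinearEquiv.toContinuousLinearMap
      map_add' := fun _ _ => rfl
      map_smul' := fun _ _ => rfl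
      left_inv := fun φ => by
        ext w
        change φ (ρ g⁻¹ (ρ g w)) = φ w
        have h : ρ (g⁻¹ * g) w = w := by simp
        rw [map_mul] at h
        exact congrArg φ h
      right_inv := fun φ => by
        ext w
        change φ (ρ g (ρ g⁻¹ w)) = φ w
        have h : ρ (g * g⁻¹) w = w := by simp
        rw [map_mul] at h
        exact congrArg φ h
      norm_map' := fun φ => ContinuousLinearMap.opNorm_comp_linearIsometryEquiv φ (ρ g⁻¹) }
  map_one' := by
    ext φ w
    simp
  map_mul' g h := by
    ext φ w
    simp

@[simp] theorem dualAction_apply (ρ : G →* (V ≃ₗᵢ[ℝ] V)) (g : G) (φ : StrongDual ℝ V) (w : V) :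
    dualAction ρ g φ w = φ (ρ g⁻¹ w) := rfl

end Dual

namespace BddCohomology

variable {G : Type*} [Group G]
variable {W : Type*} [NormedAddCommGroup W] [NormedSpace ℝ W] (σ : G →* (W ≃ₗᵢ[ℝ] W))
variable (S : Type*) [MulAction G S] {T : Type*} [MulAction G T]

/-- The bounded `G`-equivariant maps `S^{n+1} → W`, where `G` acts diagonally on `S^{n+1}`. They
are the `G`-invariants of the `G`-module of bounded linear maps from `ℝ[S^{n+1}]` (with the
`ℓ^1`-norm) to `W`, a linear map being given by its values on the basis `S^{n+1}`. -/
def cochains (n : ℕ) : Submodule ℝ ((Fin (n + 1) → S) → W) where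
  carrier := {f | (∃ C : ℝ, ∀ x, ‖f x‖ ≤ C) ∧ ∀ (g : G) (x : Fin (n + 1) → S),
    f (g • x) = σ g (f x)}
  add_mem' := by
    rintro f f' ⟨⟨C, hC⟩, hf⟩ ⟨⟨C', hC'⟩, hf'⟩
    refine ⟨⟨C + C', fun x => (norm_add_le _ _).trans (add_le_add (hC x) (hC' x))⟩,
      fun g x => ?_⟩
    simp [hf, hf']
  zero_mem' := ⟨⟨0, fun x => by simp⟩, fun g x => by simp⟩
  smul_mem' := by
    rintro r f ⟨⟨C, hC⟩, hf⟩
    refine ⟨⟨|r| * C, fun x => ?_⟩, fun g x => by simp [hf]⟩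
    simpa [norm_smul] using mul_le_mul_of_nonneg_left (hC x) (abs_nonneg r)

/-- The differential
`(δ f)(x₀, …, x_{n+1}) = ∑ᵢ (-1)^i f(x₀, …, x̂ᵢ, …, x_{n+1})`. -/
def d (n : ℕ) : cochains σ S n →ₗ[ℝ] cochains σ S (n + 1) where
  toFun f := ⟨fun x => ∑ i : Fin (n + 2), (-1 : ℝ) ^ (i : ℕ) • f.1 (fun j => x (i.succAbove j)), by
    obtain ⟨f, ⟨C, hC⟩, hf⟩ := f
    refine ⟨⟨∑ _i : Fin (n + 2), C, fun x => (norm_sum_le _ _).trans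
      (Finset.sum_le_sum fun i _ => ?_)⟩, fun g x => ?_⟩
    · simpa [norm_smul] using hC _
    · rw [map_sum]
      refine Finset.sum_congr rfl fun i _ => ?_
      rw [map_smul]
      congr 1
      exact hf g fun j => x (i.succAbove j)⟩
  map_add' f f' := by
    ext x
    simp [Finset.sum_add_distrib]
  map_smul' r f := by
    ext x
    simp [Finset.smul_sum, smul_comm r]

/-- The cocycles of degree `n`. -/
def cocycles (n : ℕ) : Submodule ℝ (cochains σ S n) := LinearMap.ker (d σ S n)

instance instAddCommGroupCocycles (n : ℕ) : AddCommGroup (cocycles σ S n) := Submodule.addCommGroup _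

/-- The coboundaries of degree `n`; there are none but `0` in degree `0`. -/
def coboundaries : (n : ℕ) → Submodule ℝ (cochains σ S n)
  | 0 => ⊥
  | n + 1 => LinearMap.range (d σ S n)

theorem d_d (n : ℕ) (f : cochains σ S n) : d σ S (n + 1) (d σ S n f) = 0 := by
  ext x
  change ∑ i : Fin (n + 3), (-1 : ℝ) ^ (i : ℕ) • ∑ j : Fin (n + 2), (-1 : ℝ) ^ (j : ℕ) •
    f.1 (fun k => x (i.succAbove (j.succAbove k))) = 0
  simp_rw [Finset.smul_sum, smul_smul, ← pow_add]
  rw [← Finset.sum_product']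
  refine Finset.sum_ninvolution (fun p => (p.1.succAbove p.2, p.2.predAbove p.1)) ?_ ?_ ?_ ?_
  · rintro ⟨i, j⟩
    simp_rw [Fin.neg_one_pow_succAbove_add_predAbove,
      Fin.succAbove_succAbove_succAbove_predAbove, neg_smul]
    exact add_neg_cancel _
  · rintro ⟨i, j⟩ - h
    exact Fin.succAbove_ne i j (congrArg Prod.fst h)
  · simp
  · rintro ⟨i, j⟩
    simp [Fin.succAbove_succAbove_predAbove, Fin.predAbove_predAbove_succAbove]

theorem coboundaries_le_cocycles (n : ℕ) : coboundaries σ S n ≤ cocycles σ S n := by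
  cases n with
  | zero => exact bot_le
  | succ n =>
    rintro _ ⟨f, rfl⟩
    exact d_d σ S n f

/-- The `n`-th cohomology of the complex of bounded `G`-equivariant maps `S^{*+1} → W`:
cocycles modulo coboundaries. -/
abbrev H (n : ℕ) : Type _ :=
  cocycles σ S n ⧸ (coboundaries σ S n).comap (cocycles σ S n).subtype

variable {S}

/-- The pull-back of cochains along a `G`-map `p : S → T`. -/
def pullback (p : S →[G] T) (n : ℕ) : cochains σ T n →ₗ[ℝ] cochains σ S n where
  toFun f := ⟨fun x => f.1 (fun j => p (x j)), by
    obtain ⟨f, ⟨C, hC⟩, hf⟩ := f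
    refine ⟨⟨C, fun x => hC _⟩, fun g x => ?_⟩
    rw [← hf]
    exact congrArg f (funext fun j => map_smul p g (x j))⟩
  map_add' _ _ := rfl
  map_smul' _ _ := rfl

theorem d_pullback (p : S →[G] T) (n : ℕ) (f : cochains σ T n) :
    d σ S n (pullback σ p n f) = pullback σ p (n + 1) (d σ T n f) := rfl

theorem pullback_mem_cocycles (p : S →[G] T) (n : ℕ) (f : cochains σ T n)
    (hf : f ∈ cocycles σ T n) : pullback σ p n f ∈ cocycles σ S n := by
  rw [cocycles, LinearMap.mem_ker] at hf ⊢
  rw [d_pullback, hf, map_zero]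

theorem pullback_mem_coboundaries (p : S →[G] T) (n : ℕ) (f : cochains σ T n)
    (hf : f ∈ coboundaries σ T n) : pullback σ p n f ∈ coboundaries σ S n := by
  cases n with
  | zero =>
    have h0 : f = 0 := hf
    rw [h0, map_zero]
    exact Submodule.zero_mem _
  | succ n =>
    obtain ⟨e, rfl⟩ := hf
    exact ⟨pullback σ p n e, rfl⟩

/-- The map `H^n(T) → H^n(S)` induced on cohomology by a `G`-map `p : S → T`. -/
def mapH (p : S →[G] T) (n : ℕ) : H σ T n →ₗ[ℝ] H σ S n :=
  Submodule.mapQ _ _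
    ((pullback σ p n).restrict (pullback_mem_cocycles σ p n))
    fun f hf => pullback_mem_coboundaries σ p n f.1 hf

end BddCohomology

section Bredon

variable {G : Type*} [Group G]
variable {W : Type*} [NormedAddCommGroup W] [NormedSpace ℝ W]

/-- The bounded Bredon cohomology `H^n_{F,b}(G;W)`: the cohomology of the complex of bounded
`G`-equivariant maps `(G/F)^{n+1} → W`. -/
abbrev BddBredonCohomology (F : SubgroupFamily G) (σ : G →* (W ≃ₗᵢ[ℝ] W)) (n : ℕ) : Type _ :=
  BddCohomology.H σ F.Cosets n

/-- The bounded cohomology `H^n_b(G;W)`: the cohomology of the complex of bounded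
`G`-equivariant maps `G^{n+1} → W`. -/
abbrev BddGroupCohomology (σ : G →* (W ≃ₗᵢ[ℝ] W)) (n : ℕ) : Type _ :=
  BddCohomology.H σ G n

/-- The canonical map `H^n_{F,b}(G;W) → H^n_b(G;W)`, induced by the `G`-map `G = G/1 ⊆ G/F`. -/
def canonicalMap (F : SubgroupFamily G) (σ : G →* (W ≃ₗᵢ[ℝ] W)) (n : ℕ) :
    BddBredonCohomology F σ n →ₗ[ℝ] BddGroupCohomology σ n :=
  BddCohomology.mapH σ F.toCosets n

end Bredon

/-! From amenability to isomorphisms: a mean on `H`, pushed forward along `h ↦ x * h`, depends only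
on the coset `xH`. Thus amenable members of `F` give an equivariant family of means on `G` indexed
by `G/F`, which on `G/1` is evaluation at points (`exists_means`). Functions with values in a dual
space can be integrated weakly against them (`exists_dual_mean`). Integrating every variable of a
cochain on `G` gives a cochain on `G/F`; this is a right inverse of the pullback on cochains, and a
left inverse up to the bounded homotopy `prism` (`mapH_bijective_of_means`).

From degree one to amenability: let `V` be the module of bounded functions `(x, y) ↦ k x - k y` on
`G × G`, a model of `ℓ^∞(G)` modulo constants. The Johnson cocycle sends `(x₀, x₁)` to evaluation at
`(x₁, x₀)`, the difference of two point masses. If its class comes from `G/F`, the cocycle is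
principal on each `H` in `F`: some `φ` in the dual of `V` changes under `H` exactly as a point mass
does. A point mass minus `φ` then yields a bounded invariant functional on `ℓ^∞(H)` with value `1`
at `1`, and its normalized positive part is an invariant mean. The use of `ULift` only moves `V` to
the required universe. -/

namespace BddCohomology

/-! ### Averaging cochains and the homotopy to the identity -/

section Averaging

variable {W : Type*} [NormedAddCommGroup W] [NormedSpace ℝ W] {S T : Type*}

/-- The alternating sum of the faces of a function of `n` variables. In contrast to `d`, it is
defined for all functions, and it includes the augmentation `n = 0`. -/
def alternatingSum (n : ℕ) (f : (Fin n → S) → W) (x : Fin (n + 1) → S) : W :=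
  ∑ i : Fin (n + 1), (-1 : ℝ) ^ (i : ℕ) • f (fun j => x (i.succAbove j))

theorem alternatingSum_zero_apply (f : (Fin 0 → S) → W) (x : Fin 1 → S) (z : Fin 0 → S) :
    alternatingSum 0 f x = f z := by
  rw [alternatingSum, Fin.sum_univ_one, Fin.val_zero, pow_zero, one_smul]
  exact congrArg f (Subsingleton.elim _ _)

/-- Only the face omitting `s` loses the first entry; the others are faces of `x` with the sign
shifted. This recursion drives the inductions on the degree. -/
theorem alternatingSum_cons (n : ℕ) (f : (Fin (n + 1) → S) → W) (s : S) (x : Fin (n + 1) → S) :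
    alternatingSum (n + 1) f (Fin.cons s x) =
      f x - alternatingSum n (fun y => f (Fin.cons s y)) x := by
  have h : ∀ i : Fin (n + 1), (fun j => (Fin.cons s x : Fin (n + 2) → S) (i.succ.succAbove j)) =
      Fin.cons s (fun j => x (i.succAbove j)) := by
    intro i
    funext j
    refine Fin.cases ?_ (fun j => ?_) j <;> simp
  rw [alternatingSum, Fin.sum_univ_succ]
  simp only [h, alternatingSum, Fin.val_succ, pow_succ]
  simp [sub_eq_add_neg]

theorem alternatingSum_map (n : ℕ) (L : (T → W) →ₗ[ℝ] W) (f : T → (Fin n → S) → W)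
    (x : Fin (n + 1) → S) :
    alternatingSum n (fun z => L fun y => f y z) x = L fun y => alternatingSum n (f y) x := by
  have h : (fun y => alternatingSum n (f y) x) = ∑ i : Fin (n + 1), (-1 : ℝ) ^ (i : ℕ) •
      fun y => f y (fun j => x (i.succAbove j)) := by
    funext y
    simp [alternatingSum]
  rw [h, map_sum]
  simp [alternatingSum]

theorem alternatingSum_sub (n : ℕ) (f f' : (Fin n → S) → W) :
    alternatingSum n (fun z => f z - f' z) = alternatingSum n f - alternatingSum n f' := by
  funext x
  simp [alternatingSum, smul_sub]

/-- Integrate a function of `n` variables in `T` successively with respect to the functionals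
`m s₁, …, m sₙ`. -/
def average (m : S → (T → W) →ₗ[ℝ] W) : (n : ℕ) → ((Fin n → T) → W) → (Fin n → S) → W
  | 0, f, _ => f Fin.elim0
  | n + 1, f, x => m (x 0) fun y => average m n (fun z => f (Fin.cons y z)) (Fin.tail x)

theorem average_sub (m : S → (T → W) →ₗ[ℝ] W) (n : ℕ) (f f' : (Fin n → T) → W) :
    average m n (fun z => f z - f' z) = average m n f - average m n f' := by
  induction n with
  | zero => rfl
  | succ n ih =>
    funext x
    simp only [average, ih, Pi.sub_apply]
    exact map_sub (m (x 0)) _ _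

/-- After peeling off the first variable, the face that omits it is constant in the integration
variable, so normalization applies; the induction hypothesis treats the rest. The augmentation is
the base case. -/
theorem average_alternatingSum {m : S → (T → W) →ₗ[ℝ] W} (hm : ∀ s w, m s (fun _ => w) = w)
    (n : ℕ) (f : (Fin n → T) → W) :
    average m (n + 1) (alternatingSum n f) = alternatingSum n (average m n f) := by
  induction n with
  | zero =>
    funext x
    rw [alternatingSum_zero_apply _ _ Fin.elim0]
    simp only [average, alternatingSum_zero_apply _ _ Fin.elim0, hm]
  | succ n ih =>
    funext x
    refine Fin.consCases (fun s x => ?_) x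
    rw [alternatingSum_cons, average]
    simp only [alternatingSum_cons, average_sub, ih, Fin.cons_zero, Fin.tail_cons, Pi.sub_apply]
    refine (map_sub (m s) (fun _ => average m (n + 1) f x) _).trans ?_
    simp only [average, Fin.cons_zero, Fin.tail_cons, alternatingSum_map, hm]

theorem norm_average_le {m : S → (T → W) →ₗ[ℝ] W}
    (hm : ∀ s f (C : ℝ), (∀ t, ‖f t‖ ≤ C) → ‖m s f‖ ≤ C)
    (n : ℕ) {f : (Fin n → T) → W} {C : ℝ} (hf : ∀ x, ‖f x‖ ≤ C) (x : Fin n → S) :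
    ‖average m n f x‖ ≤ C := by
  induction n with
  | zero => exact hf _
  | succ n ih => exact hm _ _ _ fun y => ih (fun z => hf _) _

/-- Rewrites averaging after pullback as averaging for the pushed-forward means, the form to which
`prism` applies. -/
theorem average_comp {U : Type*} (m : S → (T → W) →ₗ[ℝ] W) (p : T → U) (n : ℕ)
    (f : (Fin n → U) → W) :
    average m n (fun z => f (fun j => p (z j))) =
      average (fun s => (m s).comp (LinearMap.funLeft ℝ W p)) n f := by
  induction n with
  | zero =>
    funext x
    exact congrArg f (Subsingleton.elim _ _)
  | succ n ih =>
    funext x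
    simp only [average, LinearMap.comp_apply]
    congr 1
    funext y
    rw [LinearMap.funLeft_apply, ← ih]
    congr 1
    funext z
    congr 1
    funext j
    refine Fin.cases ?_ (fun j => ?_) j <;> simp

theorem average_eq_of_dirac {m : S → (T → W) →ₗ[ℝ] W}
    (hb : ∀ s f (C : ℝ), (∀ t, ‖f t‖ ≤ C) → ‖m s f‖ ≤ C) {p : T → S}
    (hp : ∀ t f (C : ℝ), (∀ t, ‖f t‖ ≤ C) → m (p t) f = f t) (n : ℕ) {f : (Fin n → T) → W}
    {C : ℝ} (hf : ∀ x, ‖f x‖ ≤ C) (x : Fin n → T) :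
    average m n f (fun j => p (x j)) = f x := by
  induction n with
  | zero => exact congrArg f (Subsingleton.elim _ _)
  | succ n ih =>
    rw [average, hp _ _ C fun y => norm_average_le hb _ (fun z => hf _) _]
    refine (ih (fun z => hf _) (Fin.tail x)).trans ?_
    rw [Fin.cons_self_tail]

/-- The prism operator between the identity and `average m`. -/
def prism (m : S → (S → W) →ₗ[ℝ] W) : (n : ℕ) → ((Fin (n + 1) → S) → W) → (Fin n → S) → W
  | 0, _, _ => 0
  | n + 1, f, x => m (x 0) fun y =>
      f (Fin.cons y x) - prism m n (fun z => f (Fin.cons y z)) (Fin.tail x)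

theorem prism_sub (m : S → (S → W) →ₗ[ℝ] W) (n : ℕ) (f f' : (Fin (n + 1) → S) → W) :
    prism m n (fun z => f z - f' z) = prism m n f - prism m n f' := by
  induction n with
  | zero =>
    funext x
    exact (sub_zero _).symm
  | succ n ih =>
    funext x
    simp only [prism, ih, Pi.sub_apply]
    rw [← map_sub]
    congr 1
    funext y
    simp only [Pi.sub_apply]
    abel

/-- Unrolled, `prism` integrates `∑ (-1)^i f(y₀, …, yᵢ, xᵢ, …)` over the `yⱼ`, the usual prism
between the `x`- and the `y`-simplex. -/
theorem prism_alternatingSum_add {m : S → (S → W) →ₗ[ℝ] W} (hm : ∀ s w, m s (fun _ => w) = w)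
    (n : ℕ) (f : (Fin (n + 1) → S) → W) :
    prism m (n + 1) (alternatingSum (n + 1) f) + alternatingSum n (prism m n f) =
      f - average m (n + 1) f := by
  induction n with
  | zero =>
    funext x
    refine Fin.consCases (fun s x => ?_) x
    simp only [Pi.add_apply, prism, alternatingSum_cons, Pi.sub_apply, average, Fin.cons_zero]
    rw [alternatingSum_zero_apply _ _ x]
    simp only [alternatingSum_zero_apply _ _ x, sub_zero, add_zero]
    refine (map_sub (m s) (fun _ => f (Fin.cons s x)) _).trans ?_
    rw [hm, Subsingleton.elim x Fin.elim0]
  | succ n ih =>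
    funext x
    refine Fin.consCases (fun s x => ?_) x
    -- The induction hypothesis for `f(y, ·)` splits the integrand. Once integrated, its prism terms
    -- cancel against `alternatingSum` of `prism m (n + 1) f`.
    have key : ∀ y, alternatingSum (n + 2) f (Fin.cons y (Fin.cons s x)) -
          prism m (n + 1) (fun z => alternatingSum (n + 2) f (Fin.cons y z)) x =
        (f (Fin.cons s x) - prism m (n + 1) f x) +
        (alternatingSum n (fun z => f (Fin.cons y (Fin.cons s z))
            - prism m n (fun z => f (Fin.cons y z)) z) x -
          average m (n + 1) (fun z => f (Fin.cons y z)) x) := by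
      intro y
      have h := congrFun (ih fun z => f (Fin.cons y z)) x
      simp only [Pi.add_apply, Pi.sub_apply] at h
      simp only [alternatingSum_cons, prism_sub, alternatingSum_sub, Pi.sub_apply]
      rw [eq_sub_iff_add_eq.2 h]
      abel
    rw [Pi.add_apply, prism, alternatingSum_cons]
    simp only [Fin.cons_zero, Fin.tail_cons, key]
    have e1 := map_add (m s) (fun _ => f (Fin.cons s x) - prism m (n + 1) f x)
      (fun y => alternatingSum n (fun z => f (Fin.cons y (Fin.cons s z))
            - prism m n (fun z => f (Fin.cons y z)) z) x -
          average m (n + 1) (fun z => f (Fin.cons y z)) x)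
    have e2 := map_sub (m s) (fun y => alternatingSum n (fun z => f (Fin.cons y (Fin.cons s z))
            - prism m n (fun z => f (Fin.cons y z)) z) x)
          (fun y => average m (n + 1) (fun z => f (Fin.cons y z)) x)
    rw [hm] at e1
    refine (congrArg₂ (· + ·) (e1.trans (congrArg₂ (· + ·) rfl e2)) rfl).trans ?_
    simp only [Pi.sub_apply, prism, Fin.cons_zero, Fin.tail_cons, alternatingSum_map]
    rw [average.eq_2 m (n + 1)]
    simp only [Fin.cons_zero, Fin.tail_cons]
    abel

theorem norm_prism_le {m : S → (S → W) →ₗ[ℝ] W}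
    (hm : ∀ s f (C : ℝ), (∀ t, ‖f t‖ ≤ C) → ‖m s f‖ ≤ C) (n : ℕ) {f : (Fin (n + 1) → S) → W}
    {C : ℝ} (hf : ∀ x, ‖f x‖ ≤ C) (x : Fin n → S) : ‖prism m n f x‖ ≤ n * C := by
  induction n with
  | zero => simp [prism]
  | succ n ih =>
    refine hm _ _ _ fun y => (norm_sub_le _ _).trans ?_
    have h1 := hf (Fin.cons y x)
    have h2 := ih (f := fun z => f (Fin.cons y z)) (fun z => hf _) (Fin.tail x)
    push_cast
    linarith

section Equivariant

variable {G : Type*} [Group G] [MulAction G S] [MulAction G T] (σ : G →* (W ≃ₗᵢ[ℝ] W))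

theorem smul_cons (n : ℕ) (g : G) (s : S) (x : Fin n → S) :
    g • (Fin.cons s x : Fin (n + 1) → S) = Fin.cons (g • s) (g • x) := by
  funext j
  refine Fin.cases ?_ (fun j => ?_) j <;> simp

/-- Fixing the first variable destroys equivariance of `f`, so the induction needs arbitrary bounded
`f` and its conjugate; `cochains_conj_eq` then specializes to cochains. -/
theorem average_smul {m : S → (T → W) →ₗ[ℝ] W}
    (hb : ∀ s f (C : ℝ), (∀ t, ‖f t‖ ≤ C) → ‖m s f‖ ≤ C)
    (hm : ∀ (g : G) s f (C : ℝ), (∀ t, ‖f t‖ ≤ C) →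
      m (g • s) (fun t => σ g (f (g⁻¹ • t))) = σ g (m s f))
    (n : ℕ) {f : (Fin n → T) → W} {C : ℝ} (hf : ∀ x, ‖f x‖ ≤ C) (g : G) (x : Fin n → S) :
    average m n (fun z => σ g (f (g⁻¹ • z))) (g • x) = σ g (average m n f x) := by
  induction n with
  | zero => exact congrArg (fun z => σ g (f z)) (Subsingleton.elim _ _)
  | succ n ih =>
    rw [average, average, ← hm g _ _ C fun y => norm_average_le hb _ (fun z => hf _) _]
    congr 1
    funext y
    simp only [smul_cons]
    exact ih (f := fun z => f (Fin.cons (g⁻¹ • y) z)) (fun z => hf _) (Fin.tail x)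

theorem prism_smul {m : S → (S → W) →ₗ[ℝ] W}
    (hb : ∀ s f (C : ℝ), (∀ t, ‖f t‖ ≤ C) → ‖m s f‖ ≤ C)
    (hm : ∀ (g : G) s f (C : ℝ), (∀ t, ‖f t‖ ≤ C) →
      m (g • s) (fun t => σ g (f (g⁻¹ • t))) = σ g (m s f))
    (n : ℕ) {f : (Fin (n + 1) → S) → W} {C : ℝ} (hf : ∀ x, ‖f x‖ ≤ C) (g : G) (x : Fin n → S) :
    prism m n (fun z => σ g (f (g⁻¹ • z))) (g • x) = σ g (prism m n f x) := by
  induction n with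
  | zero => exact (map_zero (σ g)).symm
  | succ n ih =>
    rw [prism, prism, ← hm g _ _ (C + n * C) fun y => (norm_sub_le _ _).trans
      (add_le_add (hf _) (norm_prism_le hb _ (fun z => hf _) _))]
    congr 1
    funext y
    simp only [smul_cons, map_sub, inv_smul_smul]
    congr 1
    exact ih (f := fun z => f (Fin.cons (g⁻¹ • y) z)) (fun z => hf _) (Fin.tail x)

theorem cochains_conj_eq {n : ℕ} (f : cochains σ S n) (g : G) :
    (fun z => σ g (f.1 (g⁻¹ • z))) = f.1 := by
  funext z
  rw [← f.2.2, smul_inv_smul]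

theorem mk_eq_zero_iff {n : ℕ} (f : cocycles σ S n) :
    (Submodule.Quotient.mk f : H σ S n) = 0 ↔ f.1 ∈ coboundaries σ S n :=
  Submodule.Quotient.mk_eq_zero _

/-- If there is an equivariant family of `W`-valued means on `T`, indexed by `S`, that is given by
evaluation along a `G`-map `p : T → S`, then `p` induces isomorphisms in bounded cohomology. -/
theorem mapH_bijective_of_means (p : T →[G] S) {m : S → (T → W) →ₗ[ℝ] W}
    (h1 : ∀ s w, m s (fun _ => w) = w)
    (hb : ∀ s f (C : ℝ), (∀ t, ‖f t‖ ≤ C) → ‖m s f‖ ≤ C)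
    (hm : ∀ (g : G) s f (C : ℝ), (∀ t, ‖f t‖ ≤ C) →
      m (g • s) (fun t => σ g (f (g⁻¹ • t))) = σ g (m s f))
    (hp : ∀ t f (C : ℝ), (∀ t, ‖f t‖ ≤ C) → m (p t) f = f t) (n : ℕ) :
    Function.Bijective (mapH σ p n) := by
  have avg : ∀ (k : ℕ) (f : cochains σ T k), average m (k + 1) f.1 ∈ cochains σ S k := by
    intro k f
    obtain ⟨C, hC⟩ := f.2.1
    refine ⟨⟨C, norm_average_le hb _ hC⟩, fun g x => ?_⟩
    rw [← average_smul σ hb hm _ hC, cochains_conj_eq]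
  let μ : S → (S → W) →ₗ[ℝ] W := fun s => (m s).comp (LinearMap.funLeft ℝ W p)
  have μ1 : ∀ s w, μ s (fun _ => w) = w := fun s w => h1 s w
  have μb : ∀ s f (C : ℝ), (∀ t, ‖f t‖ ≤ C) → ‖μ s f‖ ≤ C := fun s f C h =>
    hb _ _ _ fun t => h _
  have μm : ∀ (g : G) s f (C : ℝ), (∀ t, ‖f t‖ ≤ C) →
      μ (g • s) (fun t => σ g (f (g⁻¹ • t))) = σ g (μ s f) := by
    intro g s f C h
    refine Eq.trans ?_ (hm g s (fun t => f (p t)) C fun t => h _)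
    refine congrArg (m (g • s)) (funext fun t => ?_)
    simp [LinearMap.funLeft_apply, map_smul]
  have pri : ∀ (k : ℕ) (f : cochains σ S (k + 1)), prism μ (k + 1) f.1 ∈ cochains σ S k := by
    intro k f
    obtain ⟨C, hC⟩ := f.2.1
    refine ⟨⟨_, norm_prism_le μb _ hC⟩, fun g x => ?_⟩
    rw [← prism_smul σ μb μm _ hC, cochains_conj_eq]
  constructor
  · rw [injective_iff_map_eq_zero]
    intro c hc
    obtain ⟨⟨f, hf⟩, rfl⟩ := Submodule.Quotient.mk_surjective _ c
    have hf0 : alternatingSum (n + 1) f.1 = 0 := congrArg Subtype.val hf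
    have hc' : pullback σ p n f ∈ coboundaries σ T n :=
      (mk_eq_zero_iff σ ⟨_, pullback_mem_cocycles σ p n f hf⟩).1 hc
    refine (mk_eq_zero_iff σ _).2 ?_
    change f ∈ coboundaries σ S n
    have hh := prism_alternatingSum_add μ1 n f.1
    rw [hf0, show average μ (n + 1) f.1 = average m (n + 1) (pullback σ p n f).1 from
      (average_comp m p _ f.1).symm] at hh
    have h0 : ∀ (k : ℕ), prism μ (k + 1) (0 : (Fin (k + 2) → S) → W) = 0 := by
      intro k
      have := prism_sub μ (k + 1) 0 0
      rw [sub_self] at this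
      rw [← this]
      congr 1
      funext x
      simp
    rw [h0, zero_add] at hh
    -- Here `f = average (p^* f) + δ (prism f)`, and averaging preserves coboundaries. In degree `0`
    -- both summands vanish.
    cases n with
    | zero =>
      have e : pullback σ p 0 f = 0 := hc'
      change f = 0
      ext x
      have := congrFun hh x
      rw [e] at this
      have e2 : average m (0 + 1) (0 : cochains σ T 0).1 x = 0 := map_zero (m (x 0))
      rw [Pi.sub_apply, e2, sub_zero] at this
      rw [← this]
      simp [alternatingSum, prism]
    | succ n =>
      obtain ⟨b, hb'⟩ := hc'
      refine ⟨⟨_, avg n b⟩ + ⟨_, pri n f⟩, ?_⟩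
      rw [map_add]
      apply Subtype.ext
      change alternatingSum (n + 1) (average m (n + 1) b.1) +
        alternatingSum (n + 1) (prism μ (n + 1) f.1) = f.1
      rw [hh, ← average_alternatingSum h1, ← hb']
      exact add_sub_cancel _ _
  · intro c
    obtain ⟨⟨a, ha⟩, rfl⟩ := Submodule.Quotient.mk_surjective _ c
    have ha0 : alternatingSum (n + 1) a.1 = 0 := congrArg Subtype.val ha
    obtain ⟨C, hC⟩ := a.2.1
    -- The average of `a` pulls back to `a` itself, not merely to a cohomologous cocycle.
    refine ⟨Submodule.Quotient.mk ⟨⟨_, avg n a⟩, ?_⟩, ?_⟩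
    · apply Subtype.ext
      change alternatingSum (n + 1) (average m (n + 1) a.1) = 0
      rw [← average_alternatingSum h1, ha0]
      funext x
      exact norm_le_zero_iff.1 (norm_average_le hb _ (fun _ => by simp) x)
    · refine congrArg Submodule.Quotient.mk (Subtype.ext (Subtype.ext ?_))
      funext x
      exact average_eq_of_dirac hb hp _ hC x

end Equivariant

end Averaging

end BddCohomology

/-! ### Means on the cosets and with values in dual spaces -/

/-- The bounded functions `T → W`, as a subspace of all functions. -/
def boundedFunctions (T W : Type*) [NormedAddCommGroup W] [NormedSpace ℝ W] :
    Submodule ℝ (T → W) where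
  carrier := {f | ∃ C : ℝ, ∀ t, ‖f t‖ ≤ C}
  add_mem' := by
    rintro f f' ⟨C, hC⟩ ⟨C', hC'⟩
    exact ⟨C + C', fun t => (norm_add_le _ _).trans (add_le_add (hC t) (hC' t))⟩
  zero_mem' := ⟨0, fun t => by simp⟩
  smul_mem' := by
    rintro r f ⟨C, hC⟩
    refine ⟨|r| * C, fun t => ?_⟩
    simpa [norm_smul] using mul_le_mul_of_nonneg_left (hC t) (abs_nonneg r)

theorem memℓp_of_mem_boundedFunctions {T : Type*} {f : T → ℝ} (hf : f ∈ boundedFunctions T ℝ) :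
    Memℓp f ∞ := by
  obtain ⟨C, hC⟩ := hf
  refine memℓp_infty ⟨C, ?_⟩
  rintro _ ⟨t, rfl⟩
  exact hC t

theorem IsInvariantMean.abs_le {G S : Type*} [Group G] [MulAction G S]
    {m : lp (fun _ : S => ℝ) ∞ →ₗ[ℝ] ℝ} (hm : IsInvariantMean G m) (f : lp (fun _ : S => ℝ) ∞)
    {C : ℝ} (hC : ∀ s, |f s| ≤ C) : |m f| ≤ C := by
  have h1 := hm.nonneg (C • 1 - f) fun s => by
    have : f s ≤ C := (le_abs_self _).trans (hC s)
    change 0 ≤ C * 1 - f s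
    linarith
  have h2 := hm.nonneg (C • 1 + f) fun s => by
    have : -f s ≤ C := (neg_le_abs _).trans (hC s)
    change 0 ≤ C * 1 + f s
    linarith
  simp only [map_sub, map_add, map_smul, hm.normalized, smul_eq_mul, mul_one] at h1 h2
  exact _root_.abs_le.2 ⟨by linarith, by linarith⟩

/-- An invariant mean extends to a linear functional on all functions. -/
theorem IsInvariantMean.exists_extend {G S : Type*} [Group G] [MulAction G S]
    {m : lp (fun _ : S => ℝ) ∞ →ₗ[ℝ] ℝ} (hm : IsInvariantMean G m) :
    ∃ m' : (S → ℝ) →ₗ[ℝ] ℝ, (∀ c, m' (fun _ => c) = c) ∧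
      (∀ (f : S → ℝ) (C : ℝ), (∀ s, |f s| ≤ C) → |m' f| ≤ C) ∧
      ∀ (g : G) (f : S → ℝ) (C : ℝ), (∀ s, |f s| ≤ C) → m' (fun s => f (g • s)) = m' f := by
  let m₀ : boundedFunctions S ℝ →ₗ[ℝ] ℝ :=
    { toFun := fun f => m ⟨f.1, memℓp_of_mem_boundedFunctions f.2⟩
      map_add' := fun f f' => map_add m ⟨f.1, memℓp_of_mem_boundedFunctions f.2⟩
        ⟨f'.1, memℓp_of_mem_boundedFunctions f'.2⟩
      map_smul' := fun r f => map_smul m r ⟨f.1, memℓp_of_mem_boundedFunctions f.2⟩ }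
  -- The values on unbounded functions are arbitrary; the extension lets `average` and `prism` use
  -- linearity without tracking boundedness.
  obtain ⟨m', hm'⟩ := LinearMap.exists_extend m₀
  have key : ∀ f : boundedFunctions S ℝ, m' f.1 = m ⟨f.1, memℓp_of_mem_boundedFunctions f.2⟩ :=
    fun f => LinearMap.congr_fun hm' f
  refine ⟨m', fun c => ?_, fun f C hC => ?_, fun g f C hC => ?_⟩
  · have h1 : m' (fun _ => 1) = 1 := (key ⟨fun _ => 1, 1, fun _ => by simp⟩).trans hm.normalized
    have h2 : (fun _ : S => c) = c • fun _ => (1 : ℝ) := by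
      funext s
      simp
    rw [h2, map_smul, h1, smul_eq_mul, mul_one]
  · rw [key ⟨f, C, hC⟩]
    exact hm.abs_le _ hC
  · rw [key ⟨f, C, hC⟩, key ⟨fun s => f (g • s), C, fun s => hC _⟩, ← hm.invariant g]
    refine congrArg m (Subtype.ext ?_)
    funext s
    exact congrArg f (smul_inv_smul g s)

/-- Integration of functions with values in a dual space with respect to a mean. -/
theorem exists_dual_mean {T V : Type*} [Nonempty T] [NormedAddCommGroup V] [NormedSpace ℝ V]
    (m : (T → ℝ) →ₗ[ℝ] ℝ) (hm : ∀ (f : T → ℝ) (C : ℝ), (∀ t, |f t| ≤ C) → |m f| ≤ C) :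
    ∃ M : (T → StrongDual ℝ V) →ₗ[ℝ] StrongDual ℝ V, ∀ (f : T → StrongDual ℝ V) (C : ℝ),
      (∀ t, ‖f t‖ ≤ C) → (∀ v, M f v = m fun t => f t v) ∧ ‖M f‖ ≤ C := by
  have hbd : ∀ (f : T → StrongDual ℝ V) (C : ℝ), (∀ t, ‖f t‖ ≤ C) → ∀ v,
      |m fun t => f t v| ≤ C * ‖v‖ := by
    intro f C hC v
    exact hm _ _ fun t => (f t).le_of_opNorm_le (hC t) v
  let M₀ : boundedFunctions T (StrongDual ℝ V) →ₗ[ℝ] StrongDual ℝ V :=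
    { toFun := fun f => LinearMap.mkContinuousOfExistsBound
        { toFun := fun v => m fun t => f.1 t v
          map_add' := fun v w => by
            rw [← map_add]
            congr 1
            funext t
            simp
          map_smul' := fun r v => by
            rw [RingHom.id_apply, ← map_smul]
            congr 1
            funext t
            simp }
        (f.2.imp fun C hC => hbd f.1 C hC)
      map_add' := fun f f' => by
        ext v
        exact map_add m _ _
      map_smul' := fun r f => by
        ext v
        exact map_smul m r _ }
  obtain ⟨M, hM⟩ := LinearMap.exists_extend M₀
  refine ⟨M, fun f C hC => ?_⟩
  have key : ∀ v, M f v = m fun t => f t v := fun v =>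
    congrArg (fun φ : StrongDual ℝ V => φ v) (LinearMap.congr_fun hM ⟨f, C, hC⟩)
  refine ⟨key, ContinuousLinearMap.opNorm_le_bound _ ?_ fun v => ?_⟩
  · exact (norm_nonneg _).trans (hC (Classical.arbitrary T))
  · rw [key]
    exact hbd f C hC v

namespace SubgroupFamily

variable {G : Type*} [Group G]

/-- If all members of `F` are amenable, there is an equivariant family of means on `G`, indexed by
`G/F`, that consists of point evaluations on the summand `G/1`. -/
theorem exists_means (F : SubgroupFamily G) (hF : ∀ H ∈ F.carrier, IsAmenableGroup H) :
    ∃ m : F.Cosets → (G → ℝ) →ₗ[ℝ] ℝ, (∀ s c, m s (fun _ => c) = c) ∧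
      (∀ s (f : G → ℝ) (C : ℝ), (∀ t, |f t| ≤ C) → |m s f| ≤ C) ∧
      (∀ (g : G) s (f : G → ℝ) (C : ℝ), (∀ t, |f t| ≤ C) →
        m (g • s) f = m s (fun t => f (g * t))) ∧
      ∀ (t : G) (f : G → ℝ), m (F.toCosets t) f = f t := by
  have ex : ∀ H : F.carrier, ∃ m' : (H.1 → ℝ) →ₗ[ℝ] ℝ, (∀ c, m' (fun _ => c) = c) ∧
      (∀ (f : H.1 → ℝ) (C : ℝ), (∀ s, |f s| ≤ C) → |m' f| ≤ C) ∧
      ∀ (g : H.1) (f : H.1 → ℝ) (C : ℝ), (∀ s, |f s| ≤ C) →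
        m' (fun s => f (g • s)) = m' f := by
    intro H
    obtain ⟨m, hm⟩ := hF H H.2
    exact hm.exists_extend
  choose μ h1 hb hinv using ex
  refine ⟨fun s => (μ s.1).comp (LinearMap.funLeft ℝ ℝ fun h => s.2.out * (h : G)),
    fun s c => h1 _ _, fun s f C hC => hb _ _ _ fun _ => hC _, ?_, ?_⟩
  · rintro g ⟨H, c⟩ f C hC
    change μ H (fun h => f ((g • c).out * h)) = μ H (fun h => f (g * (c.out * h)))
    -- The two representatives of `g • c` differ by a right factor in `H`, which left invariance of
    -- `μ H` absorbs.
    have hmem : (g * c.out)⁻¹ * (g • c).out ∈ (H : Subgroup G) := by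
      rw [← QuotientGroup.eq, QuotientGroup.out_eq']
      exact congrArg (g • ·) (QuotientGroup.out_eq' c)
    rw [← hinv H ⟨_, hmem⟩ (fun h => f (g * (c.out * h))) C fun _ => hC _]
    congr 1
    funext h
    congr 1
    simp [mul_assoc]
  · intro t f
    change μ ⟨⊥, F.bot_mem⟩ (fun h : (⊥ : Subgroup G) => f ((t : G ⧸ (⊥ : Subgroup G)).out * h)) = f t
    have ht : (t : G ⧸ (⊥ : Subgroup G)).out = t := by
      have h := QuotientGroup.eq.1 (QuotientGroup.out_eq' (t : G ⧸ (⊥ : Subgroup G)))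
      rw [Subgroup.mem_bot, inv_mul_eq_one] at h
      exact h
    have hc : (fun h : (⊥ : Subgroup G) => f ((t : G ⧸ (⊥ : Subgroup G)).out * h)) =
        fun _ => f t := by
      funext h
      rw [ht, Subgroup.mem_bot.1 h.2, mul_one]
    rw [hc, h1]

theorem canonicalMap_bijective (F : SubgroupFamily G) (hF : ∀ H ∈ F.carrier, IsAmenableGroup H)
    {V : Type*} [NormedAddCommGroup V] [NormedSpace ℝ V] (ρ : G →* (V ≃ₗᵢ[ℝ] V)) (n : ℕ) :
    Function.Bijective (canonicalMap F (dualAction ρ) n) := by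
  obtain ⟨m, h1, hb, hm, hp⟩ := F.exists_means hF
  choose M hM using fun s => exists_dual_mean (V := V) (m s) (hb s)
  refine BddCohomology.mapH_bijective_of_means (dualAction ρ) F.toCosets (m := M) ?_ ?_ ?_ ?_ n
  · intro s w
    ext v
    rw [(hM s _ ‖w‖ fun _ => le_rfl).1, h1]
  · exact fun s f C hC => (hM s f C hC).2
  · intro g s f C hC
    ext v
    rw [(hM (g • s) _ C fun t => ?_).1, dualAction_apply, (hM s f C hC).1]
    · rw [hm g s _ (C * ‖v‖) fun t => ?_]
      · simp
      · refine (((dualAction ρ g) (f (g⁻¹ • t))).le_opNorm v).trans ?_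
        rw [LinearIsometryEquiv.norm_map]
        exact mul_le_mul_of_nonneg_right (hC _) (norm_nonneg _)
    · rw [LinearIsometryEquiv.norm_map]
      exact hC _
  · intro t f C hC
    ext v
    rw [(hM _ f C hC).1, hp]

end SubgroupFamily

/-! ### Positive parts of bounded functionals on `ℓ^∞` -/

section PositivePart

variable {S : Type*} (ψ : lp (fun _ : S => ℝ) ∞ →ₗ[ℝ] ℝ)

/-- The positive part of a functional on `ℓ^∞(S)`, evaluated at a non-negative function. -/
noncomputable def functionalPosPart (f : lp (fun _ : S => ℝ) ∞) : ℝ :=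
  sSup (ψ '' {g | (∀ s, 0 ≤ g s) ∧ ∀ s, g s ≤ f s})

variable {ψ} {K : ℝ}

theorem le_functionalPosPart (hψ : ∀ f, |ψ f| ≤ K * ‖f‖) {f g : lp (fun _ : S => ℝ) ∞}
    (h0 : ∀ s, 0 ≤ g s) (hg : ∀ s, g s ≤ f s) : ψ g ≤ functionalPosPart ψ f := by
  refine le_csSup ⟨|K| * ‖f‖, ?_⟩ ⟨g, ⟨h0, hg⟩, rfl⟩
  rintro _ ⟨k, ⟨hk0, hk⟩, rfl⟩
  refine (le_abs_self _).trans ((hψ k).trans (mul_le_mul (le_abs_self K) ?_ (norm_nonneg _)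
    (abs_nonneg _)))
  refine lp.norm_le_of_forall_le (norm_nonneg _) fun s => ?_
  rw [Real.norm_eq_abs, abs_of_nonneg (hk0 s)]
  exact (hk s).trans ((le_abs_self _).trans (lp.norm_apply_le_norm ENNReal.top_ne_zero f s))

theorem functionalPosPart_le {f : lp (fun _ : S => ℝ) ∞} {a : ℝ} (hf : ∀ s, 0 ≤ f s)
    (h : ∀ g : lp (fun _ : S => ℝ) ∞, (∀ s, 0 ≤ g s) → (∀ s, g s ≤ f s) → ψ g ≤ a) :
    functionalPosPart ψ f ≤ a := by
  refine csSup_le ⟨_, 0, ⟨fun s => le_rfl, hf⟩, rfl⟩ ?_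
  rintro _ ⟨k, ⟨hk0, hk⟩, rfl⟩
  exact h k hk0 hk

theorem functionalPosPart_nonneg (hψ : ∀ f, |ψ f| ≤ K * ‖f‖) {f : lp (fun _ : S => ℝ) ∞}
    (hf : ∀ s, 0 ≤ f s) : 0 ≤ functionalPosPart ψ f := by
  have := le_functionalPosPart hψ (g := 0) (fun s => le_rfl) hf
  rwa [map_zero] at this

/-- Riesz decomposition: if `0 ≤ g ≤ f + f'`, then `g` is the sum of `min g f ≤ f` and `g - min g f
≤ f'`. -/
theorem functionalPosPart_add (hψ : ∀ f, |ψ f| ≤ K * ‖f‖) {f f' : lp (fun _ : S => ℝ) ∞}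
    (hf : ∀ s, 0 ≤ f s) (hf' : ∀ s, 0 ≤ f' s) :
    functionalPosPart ψ (f + f') = functionalPosPart ψ f + functionalPosPart ψ f' := by
  refine le_antisymm (functionalPosPart_le (fun s => add_nonneg (hf s) (hf' s))
    fun g h0 hg => ?_) ?_
  · let k : lp (fun _ : S => ℝ) ∞ := ⟨fun s => min (g s) (f s),
      memℓp_of_mem_boundedFunctions ⟨‖f‖, fun s => by
        rw [Real.norm_eq_abs, abs_of_nonneg (le_min (h0 s) (hf s))]
        exact (min_le_right _ _).trans
          ((le_abs_self _).trans (lp.norm_apply_le_norm ENNReal.top_ne_zero f s))⟩⟩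
    have h1 := le_functionalPosPart hψ (g := k) (f := f) (fun s => le_min (h0 s) (hf s))
      fun s => min_le_right _ _
    have h2 := le_functionalPosPart hψ (g := g - k) (f := f')
      (fun s => sub_nonneg.2 (min_le_left (g s) (f s))) fun s => by
        have : g s ≤ f s + f' s := hg s
        have h3 := hf' s
        change g s - min (g s) (f s) ≤ f' s
        rcases min_choice (g s) (f s) with h | h <;> rw [h] <;> linarith
    rw [map_sub] at h2
    linarith
  · rw [← le_sub_iff_add_le]
    refine functionalPosPart_le hf fun g h0 hg => ?_
    rw [le_sub_comm]
    refine functionalPosPart_le hf' fun k hk0 hk => ?_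
    rw [le_sub_iff_add_le', ← map_add]
    exact le_functionalPosPart hψ (fun s => add_nonneg (h0 s) (hk0 s))
      fun s => add_le_add (hg s) (hk s)

theorem functionalPosPart_smul (hψ : ∀ f, |ψ f| ≤ K * ‖f‖) {f : lp (fun _ : S => ℝ) ∞}
    (hf : ∀ s, 0 ≤ f s) {r : ℝ} (hr : 0 < r) :
    functionalPosPart ψ (r • f) = r * functionalPosPart ψ f := by
  have key : ∀ {r : ℝ} {f : lp (fun _ : S => ℝ) ∞}, 0 < r → (∀ s, 0 ≤ f s) →
      functionalPosPart ψ (r • f) ≤ r * functionalPosPart ψ f := by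
    intro r f hr hf
    refine functionalPosPart_le (fun s => mul_nonneg hr.le (hf s)) fun g h0 hg => ?_
    have h := le_functionalPosPart hψ (g := r⁻¹ • g) (f := f)
      (fun s => mul_nonneg (inv_nonneg.2 hr.le) (h0 s)) fun s => (inv_mul_le_iff₀ hr).2 (hg s)
    rwa [map_smul, smul_eq_mul, inv_mul_le_iff₀ hr] at h
  refine le_antisymm (key hr hf) ?_
  have h := key (f := r • f) (inv_pos.2 hr) fun s => mul_nonneg hr.le (hf s)
  rwa [inv_smul_smul₀ hr.ne', ← div_eq_inv_mul, le_div_iff₀' hr] at h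

/-- The positive part of a bounded functional on `ℓ^∞(S)` is a linear functional. -/
theorem exists_linear_functionalPosPart (hψ : ∀ f, |ψ f| ≤ K * ‖f‖) :
    ∃ m : lp (fun _ : S => ℝ) ∞ →ₗ[ℝ] ℝ, ∀ f : lp (fun _ : S => ℝ) ∞, (∀ s, 0 ≤ f s) →
      m f = functionalPosPart ψ f := by
  let c : lp (fun _ : S => ℝ) ∞ → lp (fun _ : S => ℝ) ∞ := fun f => ‖f‖ • 1
  have hc : ∀ f s, 0 ≤ c f s := fun f s => mul_nonneg (norm_nonneg f) zero_le_one
  have hfc : ∀ f s, 0 ≤ (f + c f) s := by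
    intro f s
    have h := (neg_le_abs _).trans (lp.norm_apply_le_norm ENNReal.top_ne_zero f s)
    change 0 ≤ f s + ‖f‖ * 1
    linarith
  let m : lp (fun _ : S => ℝ) ∞ → ℝ := fun f =>
    functionalPosPart ψ (f + c f) - functionalPosPart ψ (c f)
  -- Additivity on the positive cone makes the value independent of how a function is written as a
  -- difference of non-negative ones.
  have key : ∀ a b : lp (fun _ : S => ℝ) ∞, (∀ s, 0 ≤ a s) → (∀ s, 0 ≤ b s) →
      m (a - b) = functionalPosPart ψ a - functionalPosPart ψ b := by
    intro a b ha hb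
    have h := functionalPosPart_add hψ (hfc (a - b)) hb
    rw [show a - b + c (a - b) + b = a + c (a - b) by abel,
      functionalPosPart_add hψ ha (hc _)] at h
    change functionalPosPart ψ _ - _ = _
    linarith
  have hdec : ∀ f, f = (f + c f) - c f := fun f => (add_sub_cancel_right _ _).symm
  refine ⟨{ toFun := m, map_add' := fun f f' => ?_, map_smul' := fun r f => ?_ }, fun f hf => ?_⟩
  · have h : f + f' = (f + c f + (f' + c f')) - (c f + c f') := by abel
    rw [h, key _ _ (fun s => add_nonneg (hfc f s) (hfc f' s)) fun s => add_nonneg (hc f s) (hc f' s),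
      functionalPosPart_add hψ (hfc f) (hfc f'), functionalPosPart_add hψ (hc f) (hc f')]
    change _ = (_ - _) + (_ - _)
    ring
  · rw [RingHom.id_apply, smul_eq_mul]
    change _ = r * (_ - _)
    rcases lt_trichotomy r 0 with hr | rfl | hr
    · have h : r • f = (-r) • c f - (-r) • (f + c f) := by module
      have hr' : 0 < -r := neg_pos.2 hr
      rw [h, key _ _ (fun s => mul_nonneg hr'.le (hc f s)) fun s => mul_nonneg hr'.le (hfc f s),
        functionalPosPart_smul hψ (hfc f) hr', functionalPosPart_smul hψ (hc f) hr']
      ring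
    · rw [zero_smul, zero_mul, ← sub_self (0 : lp (fun _ : S => ℝ) ∞),
        key 0 0 (fun _ => le_rfl) (fun _ => le_rfl), sub_self]
    · have h : r • f = r • (f + c f) - r • c f := by module
      rw [h, key _ _ (fun s => mul_nonneg hr.le (hfc f s)) fun s => mul_nonneg hr.le (hc f s),
        functionalPosPart_smul hψ (hfc f) hr, functionalPosPart_smul hψ (hc f) hr]
      ring
  · have h := key f 0 hf fun _ => le_rfl
    have h0 := functionalPosPart_add hψ (f := 0) (f' := 0) (fun _ => le_rfl) fun _ => le_rfl
    rw [add_zero] at h0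
    rw [sub_zero] at h
    exact h.trans (by linarith)

end PositivePart

/-! ### Translation actions and amenability from a bounded invariant functional -/

section Translation

variable {G S : Type*} [Group G] [MulAction G S]

theorem translateLp_mul (g h : G) (f : lp (fun _ : S => ℝ) ∞) :
    translateLp (g * h) f = translateLp g (translateLp h f) := by
  refine Subtype.ext (funext fun s => ?_)
  change f ((g * h)⁻¹ • s) = f (h⁻¹ • g⁻¹ • s)
  rw [mul_inv_rev, mul_smul]

theorem translateLp_one (f : lp (fun _ : S => ℝ) ∞) : translateLp (1 : G) f = f := by
  refine Subtype.ext (funext fun s => ?_)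
  change f ((1 : G)⁻¹ • s) = f s
  rw [inv_one, one_smul]

theorem norm_translateLp_le (g : G) (f : lp (fun _ : S => ℝ) ∞) : ‖translateLp g f‖ ≤ ‖f‖ :=
  lp.norm_le_of_forall_le (norm_nonneg _) fun s =>
    lp.norm_apply_le_norm ENNReal.top_ne_zero f (g⁻¹ • s)

/-- The action of `G` by translation on an invariant subspace of `ℓ^∞(S)`. -/
noncomputable def translateRep (V : Submodule ℝ (lp (fun _ : S => ℝ) ∞))
    (hV : ∀ g : G, ∀ f ∈ V, translateLp g f ∈ V) : G →* (V ≃ₗᵢ[ℝ] V) where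
  toFun g :=
    { toFun := fun f => ⟨translateLp g f.1, hV g f.1 f.2⟩
      invFun := fun f => ⟨translateLp g⁻¹ f.1, hV g⁻¹ f.1 f.2⟩
      map_add' := fun _ _ => rfl
      map_smul' := fun _ _ => rfl
      left_inv := fun f => Subtype.ext (by
        change translateLp g⁻¹ (translateLp g f.1) = f.1
        rw [← translateLp_mul, inv_mul_cancel, translateLp_one])
      right_inv := fun f => Subtype.ext (by
        change translateLp g (translateLp g⁻¹ f.1) = f.1
        rw [← translateLp_mul, mul_inv_cancel, translateLp_one])
      norm_map' := fun f => le_antisymm (norm_translateLp_le g f.1) (by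
        have h := norm_translateLp_le g⁻¹ (translateLp g f.1)
        rwa [← translateLp_mul, inv_mul_cancel, translateLp_one] at h) }
  map_one' := LinearIsometryEquiv.ext fun f => Subtype.ext (translateLp_one f.1)
  map_mul' g h := LinearIsometryEquiv.ext fun f => Subtype.ext (translateLp_mul g h f.1)

/-- A group is amenable if `ℓ^∞(G)` carries a bounded invariant functional that does not vanish on
the constant functions. -/
theorem isAmenableGroup_of_functional {ψ : lp (fun _ : G => ℝ) ∞ →ₗ[ℝ] ℝ} {K : ℝ}
    (hψ : ∀ f, |ψ f| ≤ K * ‖f‖) (h1 : ψ 1 = 1) (hinv : ∀ (g : G) f, ψ (translateLp g f) = ψ f) :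
    IsAmenableGroup G := by
  obtain ⟨m, hm⟩ := exists_linear_functionalPosPart hψ
  have one_nonneg : ∀ s, 0 ≤ (1 : lp (fun _ : G => ℝ) ∞) s := fun _ => zero_le_one
  have hpos : 0 < m 1 := by
    rw [hm 1 one_nonneg]
    exact (h1 ▸ zero_lt_one : 0 < ψ 1).trans_le
      (le_functionalPosPart hψ one_nonneg fun _ => le_rfl)
  -- Translation by `g` carries the functions between `0` and `f` to those between `0` and
  -- `translateLp g f`, and `ψ` is unchanged.
  have hle : ∀ (g : G) (f : lp (fun _ : G => ℝ) ∞), (∀ s, 0 ≤ f s) →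
      m f ≤ m (translateLp g f) := by
    intro g f hf
    rw [hm f hf, hm (translateLp g f) fun s => hf _]
    refine functionalPosPart_le hf fun k h0 hk => ?_
    rw [← hinv g]
    exact le_functionalPosPart hψ (fun s => h0 _) fun s => hk _
  have heq : ∀ (g : G) (f : lp (fun _ : G => ℝ) ∞), (∀ s, 0 ≤ f s) →
      m (translateLp g f) = m f := by
    intro g f hf
    refine le_antisymm ?_ (hle g f hf)
    have h := hle g⁻¹ (translateLp g f) fun s => hf _
    rwa [← translateLp_mul, inv_mul_cancel, translateLp_one] at h
  refine ⟨(m 1)⁻¹ • m, inv_mul_cancel₀ hpos.ne', fun f hf => ?_, fun g f => ?_⟩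
  · refine mul_nonneg (inv_nonneg.2 hpos.le) ?_
    rw [hm f hf]
    exact functionalPosPart_nonneg hψ hf
  · refine congrArg ((m 1)⁻¹ * ·) ?_
    have hf : ∀ s, 0 ≤ (f + ‖f‖ • 1) s := by
      intro s
      have h := (neg_le_abs _).trans (lp.norm_apply_le_norm ENNReal.top_ne_zero f s)
      change 0 ≤ f s + ‖f‖ * 1
      linarith
    have h := heq g _ hf
    rw [show translateLp g (f + ‖f‖ • 1) = translateLp g f + ‖f‖ • 1 from rfl, map_add,
      map_add] at h
    exact add_right_cancel h

end Translation

/-- A transversal of the right cosets of `H` splits off an `H`-component. The inverses convert the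
left cosets `G ⧸ H` to right cosets. -/
theorem Subgroup.exists_equivariant_retraction {G : Type*} [Group G] (H : Subgroup G) :
    ∃ r : G → H, ∀ (h : H) (g : G), r (h * g) = h * r g := by
  have hmem : ∀ g : G, g * ((g⁻¹ : G) : G ⧸ H).out ∈ H := by
    intro g
    have h := QuotientGroup.eq.1 (QuotientGroup.out_eq' ((g⁻¹ : G) : G ⧸ H)).symm
    rwa [inv_inv] at h
  refine ⟨fun g => ⟨_, hmem g⟩, fun h g => Subtype.ext ?_⟩
  have hc : (((h * g : G)⁻¹ : G) : G ⧸ H) = ((g⁻¹ : G) : G ⧸ H) := by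
    rw [QuotientGroup.eq]
    simp
  simp only [hc, Subgroup.coe_mul, mul_assoc]

/-! ### Bounded functions modulo constants, realized as additive cocycles -/

section Coboundary

/-- The bounded functions on `S × S` that satisfy the additive cocycle identity. -/
def additiveCocycles (S : Type*) : Submodule ℝ (lp (fun _ : S × S => ℝ) ∞) where
  carrier := {f | ∀ x y z, f (x, y) + f (y, z) = f (x, z)}
  add_mem' := by
    intro f f' hf hf' x y z
    have h := hf x y z
    have h' := hf' x y z
    change f _ + f' _ + (f _ + f' _) = f _ + f' _
    linarith
  zero_mem' := fun x y z => add_zero _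
  smul_mem' := by
    intro r f hf x y z
    have h := hf x y z
    change r * f _ + r * f _ = r * f _
    rw [← h, mul_add]

theorem translateLp_mem_additiveCocycles {G S : Type*} [Group G] [MulAction G S] (g : G)
    (f : lp (fun _ : S × S => ℝ) ∞) (hf : f ∈ additiveCocycles S) :
    translateLp g f ∈ additiveCocycles S := fun x y z => hf (g⁻¹ • x) (g⁻¹ • y) (g⁻¹ • z)

/-- The coboundary `(x, y) ↦ f (r x) - f (r y)`. -/
def additiveCoboundary {S T : Type*} (r : S → T) :
    lp (fun _ : T => ℝ) ∞ →ₗ[ℝ] additiveCocycles S where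
  toFun f := ⟨⟨fun x => f (r x.1) - f (r x.2), memℓp_of_mem_boundedFunctions
    ⟨‖f‖ + ‖f‖, fun _ => (norm_sub_le _ _).trans (add_le_add
      (lp.norm_apply_le_norm ENNReal.top_ne_zero f _)
      (lp.norm_apply_le_norm ENNReal.top_ne_zero f _))⟩⟩,
    fun x y z => sub_add_sub_cancel (f (r x)) (f (r y)) (f (r z))⟩
  map_add' _ _ := Subtype.ext (Subtype.ext (funext fun _ => add_sub_add_comm _ _ _ _))
  map_smul' c _ := Subtype.ext (Subtype.ext (funext fun _ => (mul_sub c _ _).symm))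

theorem norm_additiveCoboundary_le {S T : Type*} (r : S → T) (f : lp (fun _ : T => ℝ) ∞) :
    ‖additiveCoboundary r f‖ ≤ 2 * ‖f‖ := by
  refine lp.norm_le_of_forall_le (by positivity) fun x => ?_
  rw [two_mul]
  exact (norm_sub_le _ _).trans (add_le_add
      (lp.norm_apply_le_norm ENNReal.top_ne_zero f _)
      (lp.norm_apply_le_norm ENNReal.top_ne_zero f _))

end Coboundary

namespace BddCohomology

/-- If a `G`-map `p : G → S` induces a surjection in degree `1`, then cocycles on `G` become
principal on the stabilizers of the points of `S`. -/
theorem exists_smul_eq_add_of_surjective {G W S : Type*} [Group G] [NormedAddCommGroup W]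
    [NormedSpace ℝ W] (σ : G →* (W ≃ₗᵢ[ℝ] W)) [MulAction G S] (p : G →[G] S)
    (h : Function.Surjective (mapH σ p 1)) {a : cochains σ G 1} (ha : a ∈ cocycles σ G 1)
    (s : S) : ∃ w : W, ∀ g : G, g • s = s → σ g w = w + a.1 ![1, g] := by
  obtain ⟨c, hc⟩ := h (Submodule.Quotient.mk ⟨a, ha⟩)
  obtain ⟨⟨f, hf⟩, rfl⟩ := Submodule.Quotient.mk_surjective _ c
  obtain ⟨b, hb⟩ : pullback σ p 1 f - a ∈ coboundaries σ G 1 :=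
    (Submodule.Quotient.eq ((coboundaries σ G 1).comap (cocycles σ G 1).subtype)
      (x := ⟨_, pullback_mem_cocycles σ p 1 f hf⟩) (y := ⟨a, ha⟩)).1 hc
  have h1 : ∀ g : G, b.1 ![g] - b.1 ![1] = f.1 ![p 1, p g] - a.1 ![1, g] := by
    intro g
    have e := congrFun (congrArg Subtype.val hb) ![1, g]
    change alternatingSum 1 b.1 (Fin.cons 1 ![g]) =
      f.1 (fun j => p (![1, g] j)) - a.1 ![1, g] at e
    rw [alternatingSum_cons, alternatingSum_zero_apply _ _ Fin.elim0] at e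
    refine Eq.trans ?_ (e.trans ?_)
    · congr 3
    · refine congrArg (fun x => f.1 x - a.1 ![1, g]) (funext fun j => ?_)
      fin_cases j <;> rfl
  have h2 : ∀ g : G, f.1 ![s, p g] = f.1 ![s, p 1] + f.1 ![p 1, p g] := by
    intro g
    have e := congrFun (congrArg Subtype.val hf) ![s, p 1, p g]
    change alternatingSum 2 f.1 (Fin.cons s (Fin.cons (p 1) ![p g])) = 0 at e
    rw [alternatingSum_cons, alternatingSum_cons, alternatingSum_zero_apply _ _ Fin.elim0,
      sub_sub_eq_add_sub, sub_eq_zero] at e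
    refine Eq.trans ?_ (e.symm.trans ((add_comm _ _).trans ?_))
    · rfl
    · congr 2
  -- When `g` fixes `s`, it moves the first term by `f(p 1, p g)` and `b(1)` by `b(g) - b(1)`; since
  -- `δ b = p^* f - a`, the difference is `a(1, g)`.
  refine ⟨f.1 ![s, p 1] - b.1 ![1], fun g hg => ?_⟩
  have e1 : σ g (f.1 ![s, p 1]) = f.1 ![s, p g] := by
    rw [← f.2.2]
    refine congrArg f.1 (funext fun j => ?_)
    fin_cases j
    · exact hg
    · change g • p 1 = p g
      rw [← map_smul, smul_eq_mul, mul_one]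
  have e2 : σ g (b.1 ![1]) = b.1 ![g] := by
    rw [← b.2.2]
    refine congrArg b.1 (funext fun j => ?_)
    fin_cases j
    exact mul_one g
  rw [map_sub, e1, e2, h2, ← sub_eq_zero]
  have h3 := sub_eq_zero.2 (h1 g)
  rw [← neg_eq_zero] at h3
  rw [← h3]
  abel

end BddCohomology

/-! ### The Johnson class detects amenability -/

section Johnson

open BddCohomology

variable {G : Type u} [Group G]

variable (G) in
/-- The action of `G` by translation on the bounded additive cocycles. -/
noncomputable def additiveCocycleRep :
    G →* (additiveCocycles (ULift.{v} G) ≃ₗᵢ[ℝ] additiveCocycles (ULift.{v} G)) :=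
  translateRep _ translateLp_mem_additiveCocycles

variable (G) in
/-- The Johnson cochain, which sends `(x₀, x₁)` to the evaluation at `(x₁, x₀)`. -/
noncomputable def johnsonCochain : cochains (dualAction (additiveCocycleRep.{u, v} G)) G 1 :=
  ⟨fun x => LinearMap.mkContinuous
      { toFun := fun f => f.1 (ULift.up (x 1), ULift.up (x 0))
        map_add' := fun _ _ => rfl
        map_smul' := fun _ _ => rfl } 1
      fun f => by
        rw [one_mul]
        exact lp.norm_apply_le_norm ENNReal.top_ne_zero f.1 _, by
    refine ⟨⟨1, fun x => LinearMap.mkContinuous_norm_le _ zero_le_one _⟩, fun g x => ?_⟩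
    ext f
    change f.1 (ULift.up (g • x 1), ULift.up (g • x 0)) =
      f.1 (g⁻¹⁻¹ • (ULift.up (x 1), ULift.up (x 0)))
    rw [inv_inv]
    rfl⟩

theorem johnsonCochain_mem_cocycles :
    johnsonCochain.{u, v} G ∈ cocycles (dualAction (additiveCocycleRep.{u, v} G)) G 1 := by
  refine Subtype.ext (funext fun x => ?_)
  ext f
  have h := f.2 (ULift.up (x 2)) (ULift.up (x 1)) (ULift.up (x 0))
  change (∑ i : Fin 3, (-1 : ℝ) ^ (i : ℕ) •
    (johnsonCochain.{u, v} G).1 fun j => x (i.succAbove j)) f = 0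
  simp only [Fin.sum_univ_three, add_apply, smul_apply]
  change (-1 : ℝ) ^ 0 * f.1 (ULift.up (x 2), ULift.up (x 1)) +
    (-1 : ℝ) ^ 1 * f.1 (ULift.up (x 2), ULift.up (x 0)) +
    (-1 : ℝ) ^ 2 * f.1 (ULift.up (x 1), ULift.up (x 0)) = 0
  linarith

/-- If the Johnson class lies in the image of the canonical map, then all members of the family are
amenable. -/
theorem isAmenableGroup_of_surjective (F : SubgroupFamily G)
    (h : Function.Surjective (canonicalMap F (dualAction (additiveCocycleRep.{u, v} G)) 1))
    (H : Subgroup G) (hH : H ∈ F.carrier) : IsAmenableGroup H := by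
  obtain ⟨φ, hφ⟩ := exists_smul_eq_add_of_surjective _ F.toCosets h
    johnsonCochain_mem_cocycles.{u, v} ⟨⟨H, hH⟩, ((1 : G) : G ⧸ H)⟩
  have hφ : ∀ g : H, dualAction (additiveCocycleRep.{u, v} G) g φ =
      φ + (johnsonCochain.{u, v} G).1 ![1, (g : G)] := fun g =>
    hφ g (congrArg (Sigma.mk _) (QuotientGroup.eq.2 (by simp)))
  obtain ⟨r, hr⟩ := H.exists_equivariant_retraction
  let D := additiveCoboundary fun x : ULift.{v} G => r x.down
  -- Evaluation at `r 1` and `φ ∘ D` change by the same amount under `H`, so their difference is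
  -- invariant. Since `D` kills constants, `ψ 1 = 1`.
  let ψ : lp (fun _ : H => ℝ) ∞ →ₗ[ℝ] ℝ :=
    { toFun := fun f => f (r 1) - φ (D f)
      map_add' := fun f f' => by
        rw [map_add, map_add]
        exact add_sub_add_comm _ _ _ _
      map_smul' := fun c f => by
        rw [map_smul, map_smul]
        exact (mul_sub c _ _).symm }
  refine isAmenableGroup_of_functional (ψ := ψ) (K := 1 + ‖φ‖ * 2) (fun f => ?_) ?_ fun g f => ?_
  · rw [add_mul, one_mul, mul_assoc]
    refine (abs_sub _ _).trans (add_le_add (lp.norm_apply_le_norm ENNReal.top_ne_zero f _) ?_)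
    exact (φ.le_opNorm _).trans
      (mul_le_mul_of_nonneg_left (norm_additiveCoboundary_le _ f) (norm_nonneg φ))
  · have hD : D 1 = 0 := Subtype.ext (Subtype.ext (funext fun _ => sub_self (1 : ℝ)))
    change 1 - φ (D 1) = (1 : ℝ)
    rw [hD, map_zero, sub_zero]
  -- The inverse appears because the dual action of `g⁻¹` evaluates `φ` on the translate by `g`.
  · have e := congrArg (fun χ : StrongDual ℝ (additiveCocycles (ULift.{v} G)) => χ (D f))
      (hφ g⁻¹)
    have e1 : additiveCocycleRep.{u, v} G (g⁻¹ : H)⁻¹ (D f) = D (translateLp g f) := by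
      have e2 : ∀ y, r ((g⁻¹ : H)⁻¹⁻¹ * y) = g⁻¹ * r y := fun y => by rw [← hr, inv_inv]
      refine Subtype.ext (Subtype.ext (funext fun x => ?_))
      exact congrArg₂ (fun a b => f a - f b) (e2 x.1.down) (e2 x.2.down)
    change φ (additiveCocycleRep.{u, v} G (g⁻¹ : H)⁻¹ (D f)) =
      φ (D f) + (f (r (g⁻¹ : H)) - f (r 1)) at e
    change f (g⁻¹ • r 1) - φ (D (translateLp g f)) = f (r 1) - φ (D f)
    rw [← e1, e]
    have e3 : r (g⁻¹ : H) = g⁻¹ • r 1 := by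
      have := hr g⁻¹ 1
      rwa [mul_one] at this
    rw [e3]
    ring

end Johnson

theorem theoremC {G : Type u} [Group G] (F : SubgroupFamily G) :
    List.TFAE [
      ∀ H ∈ F.carrier, IsAmenableGroup H,
      ∀ (V : Type (max u v)) [NormedAddCommGroup V] [NormedSpace ℝ V]
        (ρ : G →* (V ≃ₗᵢ[ℝ] V)) (n : ℕ),
        Function.Bijective (canonicalMap F (dualAction ρ) n),
      ∀ (V : Type (max u v)) [NormedAddCommGroup V] [NormedSpace ℝ V]
        (ρ : G →* (V ≃ₗᵢ[ℝ] V)),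
        Function.Bijective (canonicalMap F (dualAction ρ) 1)] := by
  tfae_have 1 → 2 := fun h V _ _ ρ n => F.canonicalMap_bijective h ρ n
  tfae_have 2 → 3 := fun h V _ _ ρ => h V ρ 1
  tfae_have 3 → 1 := fun h H hH =>
    isAmenableGroup_of_surjective.{u, v} F (h _ (additiveCocycleRep.{u, v} G)).surjective H hH
  tfae_finish
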